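/- Let $U$ be a finite-dimensional real inner product space with an orthonormal basis $z_1,\dots,z_m$, let $C(U)$ be its Clifford algebra, i.e. the real unital associative algebra generated by $U$ subject to the relations $u^2=-|u|^2$ for $u\in U$, and let $V$ be a module over $C(U)$ that is finite-dimensional over $\mathbb R$. Then there exist an inner product $(\cdot,\cdot)$ on $V$, with norm $|\cdot|$, and an orthonormal basis $v_1,\dots,v_n$ of $V$ with respect to it such that the Clifford multiplication $J_z(v)=zv$ satisfies $$|J_z(v)|=|z|\,|v|,\qquad J_z(J_z(v))=-|z|^2 v\qquad\text{for all } z\in U,\ v\in V,$$ and $(z_iv_p,v_q)\in\{0,1,-1\}$ for all $1\le i\le m$ and $1\le p,q\le n$. -/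

import Mathlib

/-- The quadratic form `u ↦ -‖u‖²` on a real inner product space. With Mathlib's convention
`ι u * ι u = Q u`, its Clifford algebra is the real algebra generated by `U` subject to
`u * u = -‖u‖²`; orthonormal vectors become anticommuting square roots of `-1`. -/
noncomputable def negNormSqForm (U : Type*) [NormedAddCommGroup U] [InnerProductSpace ℝ U] :
    QuadraticForm ℝ U :=
  -(LinearMap.BilinMap.toQuadraticMap (innerₗ U))

theorem negNormSqForm_apply (U : Type*) [NormedAddCommGroup U] [InnerProductSpace ℝ U] (u : U) :
    negNormSqForm U u = -‖u‖ ^ 2 := by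
  simp [negNormSqForm]

/-- The Clifford algebra `C(U)` of a real inner product space, with `u * u = -‖u‖²`. -/
abbrev InnerClifford (U : Type*) [NormedAddCommGroup U] [InnerProductSpace ℝ U] : Type _ :=
  CliffordAlgebra (negNormSqForm U)

/-- Clifford multiplication `J_u x = u x` of an element `x` of a `C(U)`-module by a vector `u`. -/
noncomputable def cliffordMul {U : Type*} [NormedAddCommGroup U] [InnerProductSpace ℝ U]
    {V : Type*} [AddCommGroup V] [Module (InnerClifford U) V] (u : U) (x : V) : V :=
  CliffordAlgebra.ι (negNormSqForm U) u • x

open scoped RealInnerProductSpace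

/-! The operators `J (z i)` anticommute and square to `-1`, so with `-1` they generate a finite
monoid `G` whose elements commute up to sign and square to `±1`. Averaging over `G` makes it act by
isometries. It remains to find an orthonormal basis that `G` permutes up to sign. The seed is a unit
vector `v` with each `g v` equal to `±v` or orthogonal to `v`; its orbit up to sign is then
orthonormal, and the invariant orthogonal complement supplies the next seed. Zorn's lemma organises
this iteration. -/

/-- A maximal choice of the stabiliser up to sign yields a unit vector which every member of a
finite monoid of isometries, commuting up to sign and squaring to `±1`, sends to `±` itself or to
an orthogonal vector. -/
theorem exists_unit_vector_map_eq_or_orthogonal {V : Type*} [NormedAddCommGroup V]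
    [InnerProductSpace ℝ V] {G : Submonoid (Module.End ℝ V)} (hfin : Finite G)
    (hcomm : ∀ g ∈ G, ∀ h ∈ G, g * h = h * g ∨ g * h = -(h * g))
    (hsq : ∀ g ∈ G, g * g = 1 ∨ g * g = -1)
    (hiso : ∀ g ∈ G, ∀ x y : V, ⟪g x, g y⟫ = ⟪x, y⟫)
    {W : Submodule ℝ V} (hW : ∀ g ∈ G, ∀ x ∈ W, g x ∈ W) (hne : W ≠ ⊥) :
    ∃ v ∈ W, ‖v‖ = 1 ∧ ∀ g ∈ G, ⟪g v, v⟫ = 0 ∨ g v = v ∨ g v = -v := by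
  let stab : V → Set G := fun v => {g | g.1 v = v ∨ g.1 v = -v}
  obtain ⟨w, hwW, hw0⟩ := W.ne_bot_iff.1 hne
  -- `G` has only finitely many subsets, so a maximal stabiliser exists.
  obtain ⟨v, ⟨hvW, hv0⟩, hmax⟩ := Set.Finite.exists_maximalFor' stab {v | v ∈ W ∧ v ≠ 0}
    (Set.toFinite _) ⟨w, hwW, hw0⟩
  have key : ∀ g ∈ G, ⟪g v, v⟫ = 0 ∨ g v = v ∨ g v = -v := by
    intro g hg
    -- If `a v = ±v` and `a` anticommutes with `g`, applying the isometry `a` to both arguments of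
    -- `⟪g v, v⟫` changes its sign.
    by_cases hanti : ∃ a ∈ G, (a v = v ∨ a v = -v) ∧ g * a = -(a * g)
    · obtain ⟨a, ha, hav, hga⟩ := hanti
      left
      have h1 := hiso a ha (g v) v
      have h2 : a (g v) = -(g (a v)) := by
        have := congrArg (fun f : Module.End ℝ V => f v) hga
        simp only [Module.End.mul_apply, LinearMap.neg_apply] at this
        rw [this, neg_neg]
      rw [h2] at h1
      rcases hav with h | h <;> simp only [h, map_neg, inner_neg_left, inner_neg_right] at h1 <;>
        linarith
    · rcases hsq g hg with h1 | h1
      · have hgg : g (g v) = v := by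
          simpa using congrArg (fun f : Module.End ℝ V => f v) h1
        by_cases hv' : v + g v = 0
        · exact Or.inr (Or.inr (eq_neg_of_add_eq_zero_right hv'))
        · right
          -- Now `g` commutes with the whole stabiliser of `v`, so passing to `v + g v` loses none
          -- of it and gains `g`; maximality forces `g v = ±v`.
          have hle : stab v ≤ stab (v + g v) := by
            rintro ⟨a, ha⟩ (hav : a v = v ∨ a v = -v)
            have hga : g (a v) = a (g v) := by
              rcases hcomm g hg a ha with h | h
              · exact congrArg (fun f : Module.End ℝ V => f v) h
              · exact absurd ⟨a, ha, hav, h⟩ hanti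
            change a (v + g v) = v + g v ∨ a (v + g v) = -(v + g v)
            rw [map_add, ← hga]
            rcases hav with h | h
            · left; rw [h]
            · right; rw [h, map_neg, neg_add]
          have hmem : (⟨g, hg⟩ : G) ∈ stab (v + g v) := by
            left
            change g (v + g v) = v + g v
            rw [map_add, hgg, add_comm]
          exact hmax ⟨W.add_mem hvW (hW g hg v hvW), hv'⟩ hle hmem
      -- An isometry squaring to `-1` is skew-adjoint.
      · left
        have hgg : g (g v) = -v := by
          simpa using congrArg (fun f : Module.End ℝ V => f v) h1
        have h2 := hiso g hg (g v) v
        rw [hgg, inner_neg_left, real_inner_comm] at h2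
        linarith
  refine ⟨‖v‖⁻¹ • v, W.smul_mem _ hvW, norm_smul_inv_norm (𝕜 := ℝ) hv0, fun g hg => ?_⟩
  rcases key g hg with h | h | h
  · left; simp [inner_smul_left, inner_smul_right, h]
  · right; left; rw [map_smul, h]
  · right; right; rw [map_smul, h, smul_neg]

/-- A finite monoid of isometries which commute up to sign and square to `±1` acts on some
orthonormal basis by signed permutations. -/
theorem exists_orthonormalBasis_signed_permutation {V : Type*} [NormedAddCommGroup V]
    [InnerProductSpace ℝ V] [FiniteDimensional ℝ V] {G : Submonoid (Module.End ℝ V)}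
    (hfin : Finite G)
    (hcomm : ∀ g ∈ G, ∀ h ∈ G, g * h = h * g ∨ g * h = -(h * g))
    (hsq : ∀ g ∈ G, g * g = 1 ∨ g * g = -1)
    (hiso : ∀ g ∈ G, ∀ x y : V, ⟪g x, g y⟫ = ⟪x, y⟫) :
    ∃ (n : ℕ) (v : OrthonormalBasis (Fin n) ℝ V),
      ∀ g ∈ G, ∀ p q, ⟪g (v p), v q⟫ = 0 ∨ g (v p) = v q ∨ g (v p) = -v q := by
  let P : Set (Set V) := {S | (∀ v ∈ S, ‖v‖ = 1) ∧ (∀ v ∈ S, ∀ w ∈ S, v ≠ w → ⟪v, w⟫ = 0) ∧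
    ∀ g ∈ G, ∀ v ∈ S, ∀ w ∈ S, ⟪g v, w⟫ = 0 ∨ g v = w ∨ g v = -w}
  -- An isometry with square `±1` is its own adjoint up to sign.
  have hadj : ∀ g ∈ G, ∃ h ∈ G, ∀ x y : V, ⟪g x, y⟫ = ⟪x, h y⟫ ∨ ⟪g x, y⟫ = -⟪x, h y⟫ := by
    intro g hg
    refine ⟨g, hg, fun x y => ?_⟩
    rcases hsq g hg with h | h
    · left
      have hx : g (g x) = x := by simpa using congrArg (fun f : Module.End ℝ V => f x) h
      rw [← hiso g hg (g x) y, hx]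
    · right
      have hx : g (g x) = -x := by simpa using congrArg (fun f : Module.End ℝ V => f x) h
      rw [← hiso g hg (g x) y, hx, inner_neg_left]
  have hsymm : ∀ g ∈ G, ∀ x y : V, (⟪g x, y⟫ = 0 ∨ g x = y ∨ g x = -y) →
      (⟪g y, x⟫ = 0 ∨ g y = x ∨ g y = -x) := by
    intro g hg x y h
    rcases hsq g hg with h1 | h1
    all_goals
      have hx := congrArg (fun f : Module.End ℝ V => f x) h1
      simp only [Module.End.mul_apply, LinearMap.neg_apply, Module.End.one_apply] at hx
      rcases h with h | h | h
      · left
        have := hiso g hg (g x) y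
        rw [hx, h] at this
        simpa [real_inner_comm] using this
      · right; rw [← h, hx]; simp
      · right; rw [← neg_eq_iff_eq_neg.2 h, map_neg, hx]; simp
  have hins : ∀ S ∈ P, ∀ x : V, ‖x‖ = 1 → (∀ w ∈ S, ⟪x, w⟫ = 0) →
      (∀ g ∈ G, ⟪g x, x⟫ = 0 ∨ g x = x ∨ g x = -x) →
      (∀ g ∈ G, ∀ w ∈ S, ⟪g x, w⟫ = 0 ∨ g x = w ∨ g x = -w) → insert x S ∈ P := by
    rintro S ⟨hS1, hS2, hS3⟩ x hx1 hx2 hx3 hx4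
    refine ⟨?_, ?_, ?_⟩
    · rintro v (rfl | hv)
      exacts [hx1, hS1 v hv]
    · rintro v (rfl | hv) w (rfl | hw) hvw
      · exact absurd rfl hvw
      · exact hx2 w hw
      · rw [real_inner_comm]; exact hx2 v hv
      · exact hS2 v hv w hw hvw
    · rintro g hg v (rfl | hv) w (rfl | hw)
      · exact hx3 g hg
      · exact hx4 g hg w hw
      · exact hsymm g hg _ _ (hx4 g hg v hv)
      · exact hS3 g hg v hv w hw
  obtain ⟨S, hSmax⟩ := zorn_subset P (by
    intro c hcP hc
    refine ⟨⋃₀ c, ⟨?_, ?_, ?_⟩, fun s hs => Set.subset_sUnion_of_mem hs⟩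
    · rintro v ⟨s, hs, hv⟩
      exact (hcP hs).1 v hv
    · rintro v ⟨s, hs, hv⟩ w ⟨t, ht, hw⟩
      obtain ⟨r, hr, hsr, htr⟩ := hc.directedOn s hs t ht
      exact (hcP hr).2.1 v (hsr hv) w (htr hw)
    · rintro g hg v ⟨s, hs, hv⟩ w ⟨t, ht, hw⟩
      obtain ⟨r, hr, hsr, htr⟩ := hc.directedOn s hs t ht
      exact (hcP hr).2.2 g hg v (hsr hv) w (htr hw))
  have hSP := hSmax.prop
  have hmem : ∀ x : V, insert x S ∈ P → x ∈ S := fun x hx =>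
    hSmax.le_of_ge hx (Set.subset_insert x S) (Set.mem_insert x S)
  obtain ⟨hS1, hS2, hS3⟩ := hSP
  -- A vector `g s` outside the span is not `±w` for any `w ∈ S`, hence is orthogonal to `S`. It can
  -- then be adjoined to `S`, against maximality.
  have hinv : ∀ g ∈ G, ∀ s ∈ S, g s ∈ Submodule.span ℝ S := by
    intro g hg s hs
    by_contra hnot
    have hne : ∀ w ∈ S, g s ≠ w ∧ g s ≠ -w := fun w hw =>
      ⟨fun h => hnot (h ▸ Submodule.subset_span hw),
        fun h => hnot (h ▸ Submodule.neg_mem _ (Submodule.subset_span hw))⟩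
    refine hnot (Submodule.subset_span (hmem (g s) (hins S hSmax.prop (g s) ?_ ?_ ?_ ?_)))
    · have h := hiso g hg s s
      rw [real_inner_self_eq_norm_sq, real_inner_self_eq_norm_sq, hS1 s hs] at h
      nlinarith [norm_nonneg (g s)]
    · intro w hw
      have := hS3 g hg s hs w hw
      have := hne w hw
      tauto
    · intro h hh
      have hc : h (g s) = g (h s) ∨ h (g s) = -g (h s) := by
        rcases hcomm h hh g hg with e | e
        · exact Or.inl (congrArg (fun f : Module.End ℝ V => f s) e)
        · exact Or.inr (congrArg (fun f : Module.End ℝ V => f s) e)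
      rcases hS3 h hh s hs s hs with e | e | e
      · left
        rcases hc with hc | hc <;> rw [hc]
        · rw [hiso g hg, e]
        · rw [inner_neg_left, hiso g hg, e, neg_zero]
      · right; rcases hc with hc | hc <;> simp [hc, e]
      · right; rcases hc with hc | hc <;> simp [hc, e]
    · intro h hh w hw
      exact hS3 (h * g) (G.mul_mem hh hg) s hs w hw
  have hinv' : ∀ g ∈ G, ∀ x ∈ Submodule.span ℝ S, g x ∈ Submodule.span ℝ S := by
    intro g hg
    have : Submodule.span ℝ S ≤ (Submodule.span ℝ S).comap g :=
      Submodule.span_le.2 fun s hs => hinv g hg s hs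
    exact this
  have hspan : (Submodule.span ℝ S)ᗮ = ⊥ := by
    by_contra hne
    obtain ⟨v, hvW, hv1, hv⟩ := exists_unit_vector_map_eq_or_orthogonal hfin hcomm hsq hiso
      (W := (Submodule.span ℝ S)ᗮ) (by
        intro g hg x hx
        rw [Submodule.mem_orthogonal'] at hx ⊢
        intro y hy
        obtain ⟨h, hh, e⟩ := hadj g hg
        have := hx _ (hinv' h hh y hy)
        rcases e x y with e | e <;> rw [e, this]
        exact neg_zero) hne
    have hvS : ∀ g ∈ G, ∀ w ∈ S, ⟪g v, w⟫ = 0 := by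
      intro g hg w hw
      obtain ⟨h, hh, e⟩ := hadj g hg
      have := (Submodule.mem_orthogonal' _ _).1 hvW _ (hinv h hh w hw)
      rcases e v w with e | e <;> rw [e, this]
      exact neg_zero
    have hmemS := hmem v (hins S hSmax.prop v hv1 (fun w hw => hvS 1 G.one_mem w hw) hv
      fun g hg w hw => Or.inl (hvS g hg w hw))
    have h0 := hvS 1 G.one_mem v hmemS
    rw [Module.End.one_apply, real_inner_self_eq_norm_sq, hv1] at h0
    norm_num at h0
  have hon : Orthonormal ℝ ((↑) : S → V) :=
    ⟨fun v => hS1 v v.2, fun v w hvw => hS2 v v.2 w w.2 fun h => hvw (Subtype.ext h)⟩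
  have : Finite S := hon.linearIndependent.finite
  have : Fintype S := Fintype.ofFinite S
  let b : OrthonormalBasis S ℝ V := OrthonormalBasis.mkOfOrthogonalEqBot hon (by
    rw [Subtype.range_coe]; exact hspan)
  refine ⟨Fintype.card S, b.reindex (Fintype.equivFin S), fun g hg p q => ?_⟩
  simp only [OrthonormalBasis.reindex_apply, b, OrthonormalBasis.coe_of_orthogonal_eq_bot_mk]
  exact hS3 g hg _ (Subtype.prop _) _ (Subtype.prop _)

/-! ### The finite monoid generated by anticommuting complex structures -/

/-- The monoid generated by `-1` and a family of endomorphisms. -/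
def signedClosure {V ι : Type*} [AddCommGroup V] [Module ℝ V] (J : ι → Module.End ℝ V) :
    Submonoid (Module.End ℝ V) :=
  Submonoid.closure (insert (-1) (Set.range J))

section

variable {V ι : Type*} [AddCommGroup V] [Module ℝ V] {J : ι → Module.End ℝ V}

theorem mem_signedClosure (i : ι) : J i ∈ signedClosure J :=
  Submonoid.subset_closure (Set.mem_insert_of_mem _ ⟨i, rfl⟩)

theorem signedClosure_comm (hanti : ∀ i j, i ≠ j → J i * J j = -(J j * J i)) :
    ∀ g ∈ signedClosure J, ∀ h ∈ signedClosure J, g * h = h * g ∨ g * h = -(h * g) := by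
  intro g hg h hh
  induction hg, hh using Submonoid.closure_induction₂ with
  | mem x y hx hy =>
    rcases hx with rfl | ⟨i, rfl⟩
    · left; simp
    · rcases hy with rfl | ⟨j, rfl⟩
      · left; simp
      · by_cases hij : i = j
        · left; rw [hij]
        · exact Or.inr (hanti i j hij)
  | one_left x hx => left; simp
  | one_right x hx => left; simp
  | mul_left x y z hx hy hz h1 h2 =>
    rw [mul_assoc, ← mul_assoc z]
    rcases h1 with h1 | h1 <;> rcases h2 with h2 | h2 <;> simp [h2, ← mul_assoc, h1]
  | mul_right x y z hx hy hz h1 h2 =>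
    rw [← mul_assoc, mul_assoc x]
    rcases h1 with h1 | h1 <;> rcases h2 with h2 | h2 <;>
      simp [h1, mul_assoc, ← h2] <;> simp [h2, ← mul_assoc]

theorem signedClosure_sq (hsq : ∀ i, J i * J i = -1)
    (hanti : ∀ i j, i ≠ j → J i * J j = -(J j * J i)) :
    ∀ g ∈ signedClosure J, g * g = 1 ∨ g * g = -1 := by
  intro g hg
  induction hg using Submonoid.closure_induction with
  | mem x hx =>
    rcases hx with rfl | ⟨i, rfl⟩
    · left; simp
    · exact Or.inr (hsq i)
  | one => left; simp
  | mul x y hx hy h1 h2 =>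
    have e : x * y * (x * y) = x * (y * x) * y := by simp only [mul_assoc]
    rw [e]
    have e' : x * (x * y) * y = (x * x) * (y * y) := by simp only [mul_assoc]
    rcases signedClosure_comm hanti y hy x hx with h | h <;> rw [h] <;>
      simp only [mul_neg, neg_mul, e'] <;>
      rcases h1 with h1 | h1 <;> rcases h2 with h2 | h2 <;> simp [h1, h2]

/-- Each new generator `J i` enlarges a finite set `T` only to `T ∪ J i T`: earlier generators move
past `J i` at the cost of a sign, and `J i * J i = -1` leads back into `T`. -/
theorem signedClosure_finite [Finite ι] (hsq : ∀ i, J i * J i = -1)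
    (hanti : ∀ i j, i ≠ j → J i * J j = -(J j * J i)) : Finite (signedClosure J) := by
  classical
  have := Fintype.ofFinite ι
  have key : ∀ s : Finset ι, ∃ T : Set (Module.End ℝ V), T.Finite ∧ 1 ∈ T ∧
      (∀ t ∈ T, -t ∈ T) ∧ ∀ j ∈ s, ∀ t ∈ T, J j * t ∈ T := by
    intro s
    induction s using Finset.induction_on with
    | empty => exact ⟨{1, -1}, by simp, by simp, by simp, by simp⟩
    | insert i s hi ih =>
      obtain ⟨T, hT, h1, hneg, hmul⟩ := ih
      refine ⟨T ∪ (fun t => J i * t) '' T, hT.union (hT.image _), Or.inl h1, ?_, ?_⟩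
      · rintro t (ht | ⟨t, ht, rfl⟩)
        · exact Or.inl (hneg t ht)
        · exact Or.inr ⟨-t, hneg t ht, by simp⟩
      · rintro j hj t (ht | ⟨t, ht, rfl⟩)
        · rcases Finset.mem_insert.1 hj with rfl | hj
          · exact Or.inr ⟨t, ht, rfl⟩
          · exact Or.inl (hmul j hj t ht)
        · rcases Finset.mem_insert.1 hj with rfl | hj
          · left
            simpa [← mul_assoc, hsq] using hneg t ht
          · right
            refine ⟨-(J j * t), hneg _ (hmul j hj t ht), ?_⟩
            simp only [mul_neg, ← mul_assoc]
            rw [hanti j i (fun h => hi (h ▸ hj)), neg_mul]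
  obtain ⟨T, hT, h1, hneg, hmul⟩ := key Finset.univ
  refine (hT.subset fun g hg => ?_ : (signedClosure J : Set (Module.End ℝ V)).Finite).to_subtype
  induction hg using Submonoid.closure_induction_left with
  | one => exact h1
  | mul_left x hx y hy ih =>
    rcases hx with rfl | ⟨i, rfl⟩
    · simpa using hneg y ih
    · exact hmul i (Finset.mem_univ i) y ih

end

/-! ### Invariant inner product and the Clifford module -/

/-- A finite monoid of endomorphisms squaring to `±1` preserves some inner product. -/
theorem exists_core_invariant {V : Type*} [AddCommGroup V] [Module ℝ V] [FiniteDimensional ℝ V]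
    {G : Submonoid (Module.End ℝ V)} (hfin : Finite G)
    (hsq : ∀ g ∈ G, g * g = 1 ∨ g * g = -1) :
    ∃ c : InnerProductSpace.Core ℝ V, ∀ g ∈ G, ∀ x y : V, c.inner (g x) (g y) = c.inner x y := by
  have := Fintype.ofFinite G
  let b := Module.finBasis ℝ V
  let B : V → V → ℝ := fun x y => ∑ g : G, ∑ k, b.repr (g.1 x) k * b.repr (g.1 y) k
  have hnn : ∀ x, ∀ g : G, 0 ≤ ∑ k, b.repr (g.1 x) k * b.repr (g.1 x) k := fun x g =>
    Finset.sum_nonneg fun k _ => mul_self_nonneg _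
  refine ⟨{ inner := B
            conj_inner_symm := ?_
            re_inner_nonneg := ?_
            add_left := ?_
            smul_left := ?_
            definite := ?_ }, ?_⟩
  · intro x y
    simp only [B, conj_trivial, mul_comm]
  · intro x
    exact Finset.sum_nonneg fun g _ => hnn x g
  · intro x y z
    simp only [B, map_add, Finsupp.add_apply, add_mul, Finset.sum_add_distrib]
  · intro x y r
    simp only [B, map_smul, Finsupp.smul_apply, smul_eq_mul, mul_assoc, Finset.mul_sum,
      conj_trivial]
  · intro x hx
    -- The summand at `g = 1` already detects `x`.
    have h1 := (Finset.sum_eq_zero_iff_of_nonneg fun g _ => hnn x g).1 hx 1 (Finset.mem_univ _)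
    have h2 := (Finset.sum_eq_zero_iff_of_nonneg fun k _ => mul_self_nonneg _).1 h1
    apply b.repr.injective
    ext k
    simpa using h2 k (Finset.mem_univ k)
  · intro h hh x y
    -- Right translation by `h` is injective because `h * h = ±1`, so it permutes the summands.
    have hinj : Function.Injective fun g : G => g * ⟨h, hh⟩ := by
      intro g g' e
      have e' : g.1 * h = g'.1 * h := congrArg Subtype.val e
      have e2 : g.1 * (h * h) = g'.1 * (h * h) := by rw [← mul_assoc, e', mul_assoc]
      rcases hsq h hh with h1 | h1 <;> rw [h1] at e2 <;> simpa using e2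
    exact (Finite.injective_iff_bijective.1 hinj).sum_comp
      fun g : G => ∑ k, b.repr (g.1 x) k * b.repr (g.1 y) k

/-- A finite family of anticommuting complex structures is isometric for some inner product and
acts by signed permutation matrices in some orthonormal basis. -/
theorem exists_core_basis_of_anticommuting {V ι : Type*} [AddCommGroup V] [Module ℝ V]
    [FiniteDimensional ℝ V] [Finite ι] {J : ι → Module.End ℝ V} (hsq : ∀ i, J i * J i = -1)
    (hanti : ∀ i j, i ≠ j → J i * J j = -(J j * J i)) :
    ∃ (c : InnerProductSpace.Core ℝ V) (n : ℕ) (v : Module.Basis (Fin n) ℝ V),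
      (∀ p q : Fin n, c.inner (v p) (v q) = if p = q then 1 else 0) ∧
      (∀ i (x y : V), c.inner (J i x) (J i y) = c.inner x y) ∧
      ∀ i (p q : Fin n), c.inner (J i (v p)) (v q) = 0 ∨ c.inner (J i (v p)) (v q) = 1 ∨
        c.inner (J i (v p)) (v q) = -1 := by
  have hfin := signedClosure_finite hsq hanti
  have hsq' := signedClosure_sq hsq hanti
  obtain ⟨c, hc⟩ := exists_core_invariant hfin hsq'
  let _ : NormedAddCommGroup V := c.toNormedAddCommGroup
  let _ : InnerProductSpace ℝ V := InnerProductSpace.ofCore c.toCore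
  obtain ⟨n, v, hv⟩ := exists_orthonormalBasis_signed_permutation hfin
    (signedClosure_comm hanti) hsq' hc
  have hon : ∀ p q : Fin n, c.inner (v p) (v q) = if p = q then 1 else 0 :=
    orthonormal_iff_ite.1 v.orthonormal
  refine ⟨c, n, v.toBasis, ?_, fun i => hc _ (mem_signedClosure i), fun i p q => ?_⟩
  · simpa using hon
  · rw [v.coe_toBasis]
    rcases hv _ (mem_signedClosure i) p q with h | h | h
    · exact Or.inl h
    · right; left
      rw [h, hon, if_pos rfl]
    · right; right
      rw [h]
      have : ⟪-v q, v q⟫ = -1 := by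
        rw [inner_neg_left]
        exact congrArg Neg.neg ((hon q q).trans (if_pos rfl))
      exact this

theorem theorem2 {U : Type*} [NormedAddCommGroup U] [InnerProductSpace ℝ U]
    (m : ℕ) (z : OrthonormalBasis (Fin m) ℝ U)
    {V : Type*} [AddCommGroup V] [Module ℝ V] [FiniteDimensional ℝ V]
    [Module (InnerClifford U) V] [IsScalarTower ℝ (InnerClifford U) V] :
    ∃ (c : InnerProductSpace.Core ℝ V) (n : ℕ) (v : Module.Basis (Fin n) ℝ V),
      (∀ p q : Fin n, c.inner (v p) (v q) = if p = q then 1 else 0) ∧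
      (∀ (u : U) (x : V),
        √(c.inner (cliffordMul u x) (cliffordMul u x)) = ‖u‖ * √(c.inner x x)) ∧
      (∀ (u : U) (x : V), cliffordMul u (cliffordMul u x) = -(‖u‖ ^ 2 • x)) ∧
      (∀ (i : Fin m) (p q : Fin n),
        c.inner (cliffordMul (z i) (v p)) (v q) = 0 ∨
        c.inner (cliffordMul (z i) (v p)) (v q) = 1 ∨
        c.inner (cliffordMul (z i) (v p)) (v q) = -1) := by
  let L : U →ₗ[ℝ] Module.End ℝ V :=
    (Algebra.lsmul ℝ ℝ V : InnerClifford U →ₐ[ℝ] Module.End ℝ V).toLinearMap ∘ₗ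
      CliffordAlgebra.ι (negNormSqForm U)
  have hL : ∀ u x, L u x = cliffordMul u x := fun u x => rfl
  have hsq : ∀ u, L u * L u = -(‖u‖ ^ 2 • (1 : Module.End ℝ V)) := by
    intro u
    have h : L u * L u = Algebra.lsmul ℝ ℝ V (CliffordAlgebra.ι (negNormSqForm U) u *
        CliffordAlgebra.ι (negNormSqForm U) u) := by
      rw [map_mul]; rfl
    rw [h, CliffordAlgebra.ι_sq_scalar, AlgHom.commutes, negNormSqForm_apply,
      Algebra.algebraMap_eq_smul_one, neg_smul]
  have hsq1 : ∀ i, L (z i) * L (z i) = -1 := fun i => by simp [hsq]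
  have hanti : ∀ i j, i ≠ j → L (z i) * L (z j) = -(L (z j) * L (z i)) := by
    intro i j hij
    -- Polarisation: the cross terms in the square of `L (z i + z j)` must cancel.
    have h := hsq (z i + z j)
    have hn : ‖z i + z j‖ ^ 2 = 2 := by
      rw [norm_add_sq_real, z.inner_eq_zero hij]
      norm_num
    rw [hn, map_add, add_mul, mul_add, mul_add, hsq1, hsq1, two_smul] at h
    refine eq_neg_of_add_eq_zero_left ?_
    calc L (z i) * L (z j) + L (z j) * L (z i)
        = -1 + L (z i) * L (z j) + (L (z j) * L (z i) + -1) + (1 + 1) := by abel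
      _ = 0 := by rw [h, neg_add_cancel]
  obtain ⟨c, n, v, hon, hiso, hv⟩ := exists_core_basis_of_anticommuting hsq1 hanti
  have hJJ : ∀ u x, L u (L u x) = -(‖u‖ ^ 2 • x) := fun u x => by
    simpa using congrArg (fun f : Module.End ℝ V => f x) (hsq u)
  refine ⟨c, n, v, hon, fun u x => ?_, hJJ, hv⟩
  let _ : NormedAddCommGroup V := c.toNormedAddCommGroup
  let _ : InnerProductSpace ℝ V := InnerProductSpace.ofCore c.toCore
  -- Skew-adjointness is linear in `u`, unlike the norm identity, so it extends from the `z i` to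
  -- all of `U`; with `L u * L u = -‖u‖ ^ 2` it gives the norm identity back.
  have hskew : ∀ i, ∀ x y : V, ⟪L (z i) x, y⟫ = -⟪x, L (z i) y⟫ := by
    intro i x y
    have h : ⟪L (z i) (L (z i) x), L (z i) y⟫ = ⟪L (z i) x, y⟫ := hiso i _ _
    rw [← h, hJJ, z.norm_eq_one, one_pow, one_smul, inner_neg_left]
  have hskew' : ∀ x y : V, ⟪L u x, y⟫ = -⟪x, L u y⟫ := by
    intro x y
    rw [← z.sum_repr u]
    simp only [map_sum, map_smul, LinearMap.sum_apply, LinearMap.smul_apply, sum_inner, inner_sum,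
      real_inner_smul_left, real_inner_smul_right, hskew, mul_neg, Finset.sum_neg_distrib]
  have h : ⟪L u x, L u x⟫ = ‖u‖ ^ 2 * ⟪x, x⟫ := by
    rw [hskew', hJJ, inner_neg_right, real_inner_smul_right, neg_neg]
  change √⟪L u x, L u x⟫ = ‖u‖ * √⟪x, x⟫
  rw [h, Real.sqrt_mul (sq_nonneg _), Real.sqrt_sq (norm_nonneg _)]
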